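/- Let $D\subseteq\mathbf R^n$ be an open set which is either $\mathbf R^n$ or bounded with $C^2$-smooth boundary, let $T>0$ and $Q=D\times(0,T)$. Let $H^0=L_2(D)$ with norm $\|\cdot\|$, let $H^1=\stackrel{\circ}{W}{}^1_2(D)$, and let $H^{-1}$ be the dual of $H^1$, with $H^0\subset H^{-1}$ through $(\cdot,\cdot)_{H^0}$. For vector functions, $(U,V)_{H^0}=\sum_i(U_i,V_i)_{H^0}$, and $\nabla\cdot U\in H^{-1}$ is the functional $w\mapsto-(U,\nabla w)_{H^0}$. Put $X^k=L^2([0,T];H^k)$ for $k=-1,0,1$ and $Y^1=X^1\cap C([0,T];H^0)$. For $v\in Y^1$ let $$\mathcal N(v)=\nabla\cdot\big(\widehat b(v)\nabla v\big)+\widehat f(v)\cdot\nabla v+\widehat\lambda(v)\,v+\widehat\varphi(v),$$ where, for each $v\in Y^1$, $\widehat b(v),\widehat f(v),\widehat\lambda(v)$ are functions of $(x,t)\in D\times[0,T]$ (which may depend on the whole function $v$) with values in $\mathbf R^{n\times n}$, $\mathbf R^n$, $\mathbf R$, and $\widehat\varphi(v)\in X^{-1}$. Let $u\in Y^1$ be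 a solution of $$\frac{\partial u}{\partial t}=\mathcal N(u),\quad t\in(0,T),\qquad u(\cdot,0)=0,\qquad u|_{\partial D}=0,$$ that is, $\mathcal N(u)\in X^{-1}$, $u(\cdot,0)=0$, and $u(\cdot,t)=\int_0^t\mathcal N(u)(\cdot,s)\,ds$ in $H^{-1}$ for all $t\in[0,T]$. Suppose that the frozen coefficients $b(x,t)=\widehat b(u)(x,t)$, $f(x,t)=\widehat f(u)(x,t)$, $\lambda(x,t)=\widehat\lambda(u)(x,t)$ are measurable on $Q$, that $b(x,t)$ is symmetric on $Q$, that there is a $\delta>0$ with $\xi^\top b(x,t)\xi\ge\delta|\xi|^2$ for all $\xi\in\mathbf R^n$, $(x,t)\in Q$, and that $\operatorname{ess\,sup}_{Q}\big[|b|+|b^{-1}|+|f|+|\lambda|\big]<\infty$. Suppose that the free term $\varphi=\widehat\varphi(u)$ has the form $\varphi=F_0+\nabla\cdot F$ with $F=(F_1,\dots,F_n)$ and $F_0,F_1,\dots,F_n\in L_2(Q)$, that the values at $t=0$ are such that $F_0(\cdot,0)\in H^0$, that $b(x,0)$ is invertible for almost every $x\in D$ and that $F(\cdot,0)^\top b(\cdot,0)^{-1}F(\cdot,0)$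 is integrable on $D$, and that $$\lim_{t\to0+}\frac1t\int_0^t\|F_0(\cdot,s)\|^2ds=\|F_0(\cdot,0)\|^2,\qquad \lim_{t\to0+}\frac1t\int_0^t\big(F(\cdot,s),b(\cdot,s)^{-1}F(\cdot,s)\big)_{H^0}ds=\big(F(\cdot,0),b(\cdot,0)^{-1}F(\cdot,0)\big)_{H^0}.$$ Then $$\limsup_{t\to0+}\frac1t\|u(\cdot,t)\|^2\le\frac12\big(F(\cdot,0),b(\cdot,0)^{-1}F(\cdot,0)\big)_{H^0}.$$ In particular, $F_0$ does not enter this bound. -/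

import Mathlib

open MeasureTheory Filter Topology

noncomputable section

namespace Parabolic

/-- `ℝⁿ` with its Euclidean norm. -/
abbrev Rn (n : ℕ) : Type := EuclideanSpace ℝ (Fin n)

/-- The boundary of `D` is `C²`-smooth: near each boundary point, `D` is the strict sublevel set
`{g < 0}` of a `C²` function `g` with nonvanishing differential. -/
def HasC2Boundary {n : ℕ} (D : Set (Rn n)) : Prop :=
  ∀ p ∈ frontier D, ∃ U : Set (Rn n), IsOpen U ∧ p ∈ U ∧ ∃ g : Rn n → ℝ,
    ContDiffOn ℝ 2 g U ∧ (∀ x ∈ U, fderiv ℝ g x ≠ 0) ∧ D ∩ U = {x ∈ U | g x < 0}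

/-- Lebesgue measure on `D`. -/
abbrev spaceMeasure {n : ℕ} (D : Set (Rn n)) : Measure (Rn n) := volume.restrict D

/-- Lebesgue measure on `[0,T]`. -/
abbrev timeMeasure (T : ℝ) : Measure ℝ := volume.restrict (Set.Icc 0 T)

/-- Lebesgue measure on the cylinder `Q = D × (0,T)` (the end points of the time interval carry
no mass). -/
abbrev cylMeasure {n : ℕ} (D : Set (Rn n)) (T : ℝ) : Measure (Rn n × ℝ) :=
  (spaceMeasure D).prod (timeMeasure T)

/-- `H⁰ = L₂(D)`. -/
abbrev H0 {n : ℕ} (D : Set (Rn n)) : Type := Lp ℝ 2 (spaceMeasure D)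

/-- `L₂(D; ℝⁿ)`. -/
abbrev H0vec {n : ℕ} (D : Set (Rn n)) : Type := Lp (Rn n) 2 (spaceMeasure D)

/-- The Hilbert space of pairs `(w, p)`, with `‖(w, p)‖² = ‖w‖² + ‖p‖²`; on the pairs `(w, ∇w)`
this is the norm of `W¹₂(D)`. -/
abbrev GraphSpace {n : ℕ} (D : Set (Rn n)) : Type := WithLp 2 (H0 D × H0vec D)

/-- The pairs `(w, ∇w)` for smooth `w` with compact support in `D`. -/
def testGraph {n : ℕ} (D : Set (Rn n)) : Set (GraphSpace D) :=
  {z | ∃ w : Rn n → ℝ, ContDiff ℝ (⊤ : ℕ∞) w ∧ HasCompactSupport w ∧ tsupport w ⊆ D ∧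
    z.fst =ᵐ[spaceMeasure D] w ∧ z.snd =ᵐ[spaceMeasure D] gradient w}

/-- `H¹`, the closure in the `W¹₂(D)`-norm of the smooth functions with compact support in `D`; an
element is recorded as the pair of a function and its weak gradient. -/
abbrev H1 {n : ℕ} (D : Set (Rn n)) : Submodule ℝ (GraphSpace D) :=
  (Submodule.span ℝ (testGraph D)).topologicalClosure

/-- The embedding `H¹ → H⁰`. -/
def H1.toH0 {n : ℕ} (D : Set (Rn n)) : H1 D →L[ℝ] H0 D :=
  (WithLp.fstL 2 ℝ (H0 D) (H0vec D)).comp (H1 D).subtypeL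

/-- The weak gradient `∇ : H¹ → L₂(D; ℝⁿ)`. -/
def H1.grad {n : ℕ} (D : Set (Rn n)) : H1 D →L[ℝ] H0vec D :=
  (WithLp.sndL 2 ℝ (H0 D) (H0vec D)).comp (H1 D).subtypeL

/-- `H⁻¹`, the dual of `H¹` with the dual norm. -/
abbrev Hneg1 {n : ℕ} (D : Set (Rn n)) : Type := StrongDual ℝ (H1 D)

/-- The embedding `H⁰ → H⁻¹`: `g` acts as `w ↦ (g, w)_{H⁰}`. -/
def H0.toHneg1 {n : ℕ} {D : Set (Rn n)} (g : H0 D) : Hneg1 D :=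
  (innerSL ℝ g).comp (H1.toH0 D)

/-- The divergence `∇· : L₂(D; ℝⁿ) → H⁻¹`: `∇·G` acts as `w ↦ -(G, ∇w)_{H⁰}`. -/
def divergence {n : ℕ} {D : Set (Rn n)} (G : H0vec D) : Hneg1 D :=
  -((innerSL ℝ G).comp (H1.grad D))

open Classical in
/-- The class in `L₂(D)` of a square integrable function (and `0` for other functions). -/
def toL2 {n : ℕ} (D : Set (Rn n)) {V : Type} [NormedAddCommGroup V] (g : Rn n → V) :
    Lp V 2 (spaceMeasure D) :=
  if h : MemLp g 2 (spaceMeasure D) then h.toLp g else 0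

/-- `X¹ = L²([0,T]; H¹)`. -/
abbrev X1 {n : ℕ} (D : Set (Rn n)) (T : ℝ) : Type := Lp (H1 D) 2 (timeMeasure T)

/-- `X⁻¹ = L²([0,T]; H⁻¹)`. -/
abbrev Xneg1 {n : ℕ} (D : Set (Rn n)) (T : ℝ) : Type := Lp (Hneg1 D) 2 (timeMeasure T)

/-- `Y¹ = X¹ ∩ C([0,T]; H⁰)`: an element of `X¹` together with its continuous representative. -/
structure Y1 {n : ℕ} (D : Set (Rn n)) (T : ℝ) where
  /-- the element of `L²([0,T]; H¹)` -/
  toX1 : X1 D T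
  /-- the element of `C([0,T]; H⁰)` -/
  toC0 : C(Set.Icc (0 : ℝ) T, H0 D)
  /-- both are the same function of time -/
  agree : ∀ᵐ t ∂(timeMeasure T), ∀ ht : t ∈ Set.Icc (0 : ℝ) T,
    H1.toH0 D (toX1 t) = toC0 ⟨t, ht⟩

open Classical in
/-- The value `u(·,t) ∈ H⁰` of `u ∈ Y¹` at the time `t ∈ [0,T]` (and `0` for other `t`). -/
def Y1.val {n : ℕ} {D : Set (Rn n)} {T : ℝ} (u : Y1 D T) (t : ℝ) : H0 D :=
  if ht : t ∈ Set.Icc (0 : ℝ) T then u.toC0 ⟨t, ht⟩ else 0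

/-- The product of a matrix with a vector of `ℝⁿ`. -/
def mulV {n : ℕ} (A : Matrix (Fin n) (Fin n) ℝ) (v : Rn n) : Rn n :=
  WithLp.toLp 2 (A.mulVec v.ofLp)

/-- The Frobenius norm of a matrix. -/
def frobenius {n : ℕ} (A : Matrix (Fin n) (Fin n) ℝ) : ℝ :=
  Real.sqrt (∑ i, ∑ j, A i j ^ 2)

/-- The standing conditions on the coefficients `b`, `f`, `λ` on `Q = D × (0,T)`: they are
measurable, `b` is symmetric and uniformly elliptic, and `|b| + |b⁻¹| + |f| + |λ|` is essentially
bounded. -/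
structure StandingConditions {n : ℕ} (D : Set (Rn n)) (T : ℝ)
    (b : Rn n → ℝ → Matrix (Fin n) (Fin n) ℝ) (f : Rn n → ℝ → Rn n) (lam : Rn n → ℝ → ℝ) :
    Prop where
  measurable_b : ∀ i j, AEMeasurable (fun p : Rn n × ℝ => b p.1 p.2 i j) (cylMeasure D T)
  measurable_f : AEMeasurable (fun p : Rn n × ℝ => f p.1 p.2) (cylMeasure D T)
  measurable_lam : AEMeasurable (fun p : Rn n × ℝ => lam p.1 p.2) (cylMeasure D T)
  symmetric : ∀ x ∈ D, ∀ t ∈ Set.Ioo (0 : ℝ) T, (b x t).IsSymm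
  coercive : ∃ δ : ℝ, 0 < δ ∧ ∀ x ∈ D, ∀ t ∈ Set.Ioo (0 : ℝ) T, ∀ ξ : Rn n,
    δ * ‖ξ‖ ^ 2 ≤ inner ℝ ξ (mulV (b x t) ξ)
  bounded : ∃ C : ℝ, ∀ᵐ p ∂(cylMeasure D T),
    frobenius (b p.1 p.2) + frobenius ((b p.1 p.2)⁻¹) + ‖f p.1 p.2‖ + |lam p.1 p.2| ≤ C

/-- For almost every time `s`, the element
`∇·(b(·,s) ∇v(·,s)) + f(·,s)·∇v(·,s) + λ(·,s) v(·,s)` of `H⁻¹`. -/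
def linearPart {n : ℕ} {D : Set (Rn n)} {T : ℝ}
    (b : Rn n → ℝ → Matrix (Fin n) (Fin n) ℝ) (f : Rn n → ℝ → Rn n) (lam : Rn n → ℝ → ℝ)
    (v : Y1 D T) (s : ℝ) : Hneg1 D :=
  divergence (toL2 D fun x => mulV (b x s) (H1.grad D (v.toX1 s) x)) +
    H0.toHneg1 (toL2 D fun x =>
      inner ℝ (f x s) (H1.grad D (v.toX1 s) x) + lam x s * H1.toH0 D (v.toX1 s) x)

/-- The nonlinear nonlocal operator
`𝒩(v) = ∇·(b̂(v) ∇v) + f̂(v)·∇v + λ̂(v) v + φ̂(v)`, as an `H⁻¹`-valued function of time. -/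
def nonlinOp {n : ℕ} {D : Set (Rn n)} {T : ℝ}
    (bhat : Y1 D T → Rn n → ℝ → Matrix (Fin n) (Fin n) ℝ)
    (fhat : Y1 D T → Rn n → ℝ → Rn n) (lamhat : Y1 D T → Rn n → ℝ → ℝ)
    (phihat : Y1 D T → Xneg1 D T) (v : Y1 D T) (s : ℝ) : Hneg1 D :=
  linearPart (bhat v) (fhat v) (lamhat v) v s + phihat v s

/-- `u ∈ Y¹` solves `∂u/∂t = N(u)` on `(0,T)`, `u(·,0) = 0`, `u = 0` on `∂D`: here `N(u) ∈ X⁻¹` and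
`u(·,t) = ∫₀ᵗ N(u)(·,s) ds` for all `t ∈ [0,T]`, as an equality in `H⁻¹`. The boundary condition is
contained in `u ∈ Y¹`. -/
structure IsSolution {n : ℕ} {D : Set (Rn n)} {T : ℝ} (N : Y1 D T → ℝ → Hneg1 D) (u : Y1 D T) :
    Prop where
  memLp : MemLp (N u) 2 (timeMeasure T)
  initial : u.val 0 = 0
  equation : ∀ t ∈ Set.Icc (0 : ℝ) T, H0.toHneg1 (u.val t) = ∫ s in (0 : ℝ)..t, N u s

/-- `φ = F₀ + ∇·F` in `X⁻¹`, with `F₀, F₁, …, Fₙ ∈ X⁰ = L₂(Q)`. -/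
structure Represents {n : ℕ} {D : Set (Rn n)} {T : ℝ} (phi : Xneg1 D T)
    (F0 : Rn n → ℝ → ℝ) (F : Rn n → ℝ → Rn n) : Prop where
  memLp_F0 : MemLp (fun p : Rn n × ℝ => F0 p.1 p.2) 2 (cylMeasure D T)
  memLp_F : MemLp (fun p : Rn n × ℝ => F p.1 p.2) 2 (cylMeasure D T)
  eq : ∀ᵐ s ∂(timeMeasure T), phi s =
    divergence (toL2 D fun x => F x s) + H0.toHneg1 (toL2 D fun x => F0 x s)

/-- `(F(·,s), b(·,s)⁻¹ F(·,s))_{H⁰}`. -/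
def weightedForm {n : ℕ} (D : Set (Rn n)) (b : Rn n → ℝ → Matrix (Fin n) (Fin n) ℝ)
    (F : Rn n → ℝ → Rn n) (s : ℝ) : ℝ :=
  ∫ x in D, inner ℝ (F x s) (mulV ((b x s)⁻¹) (F x s))

/-- The limit condition at `t = 0` on `F₀`: `F₀(·,0) ∈ H⁰`, and the means over `[0,t]` of
`‖F₀(·,s)‖²` tend to `‖F₀(·,0)‖²` as `t → 0+`. -/
structure LimitConditionF0 {n : ℕ} (D : Set (Rn n)) (F0 : Rn n → ℝ → ℝ) : Prop where
  memLp_zero : MemLp (fun x => F0 x 0) 2 (spaceMeasure D)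
  tendsto : Tendsto (fun t : ℝ => (1 / t) * ∫ s in (0 : ℝ)..t, ∫ x in D, F0 x s ^ 2)
    (𝓝[>] 0) (𝓝 (∫ x in D, F0 x 0 ^ 2))

/-- The limit condition at `t = 0` on `F`: `(F(·,0), b(·,0)⁻¹ F(·,0))_{H⁰}` is meaningful, and the
means over `[0,t]` of `(F(·,s), b(·,s)⁻¹ F(·,s))_{H⁰}` tend to it as `t → 0+`. -/
structure LimitConditionF {n : ℕ} (D : Set (Rn n)) (b : Rn n → ℝ → Matrix (Fin n) (Fin n) ℝ)
    (F : Rn n → ℝ → Rn n) : Prop where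
  invertible_zero : ∀ᵐ x ∂(spaceMeasure D), IsUnit (b x 0).det
  integrable_zero :
    Integrable (fun x => inner ℝ (F x 0) (mulV ((b x 0)⁻¹) (F x 0))) (spaceMeasure D)
  tendsto : Tendsto (fun t : ℝ => (1 / t) * ∫ s in (0 : ℝ)..t, weightedForm D b F s)
    (𝓝[>] 0) (𝓝 (weightedForm D b F 0))

end Parabolic

end

/-! The proof is the energy method with a careful split of the dissipation. Pairing the equation
with `u` gives `‖u(t)‖² ≤ 2 ∫₀ᵗ ⟨N(u), u⟩ ds`. In `2⟨N(u), u⟩` the fraction `1 - ε` of the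
dissipation `(b∇u, ∇u)` absorbs `-(F, ∇u)` by Young's inequality weighted by `b`, at the price `(F,
b⁻¹F) / (2(1 - ε))`. The remaining fraction `ε`, at least `εδ‖∇u‖²`, absorbs the drift term. What is
left is `ε‖F₀‖² + K‖u‖²`, with `K` depending on `ε` but not on time (`pointwise_energy_estimate`,
`ae_energy_estimate`).

After averaging over `[0,t]` and letting `t → 0+`, the term with `K` vanishes because `u` is
continuous in `H⁰` with `u(0) = 0`, and the limit conditions handle the other two. Letting `ε → 0`
afterwards removes `F₀` and leaves the factor `1/2`.

The pairing is justified by `energy_inequality`, which needs no differentiability of `‖u‖²`.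
Backward differences satisfy `‖u(s)‖² - ‖u(s-h)‖² ≤ 2(u(s) - u(s-h), u(s))`. Integrated over `s ∈
[0,t]`, the left side telescopes and the right side becomes an integral over `r ∈ [0,h]` of the
correlation of `N(u)` and `u` at lag `r`. This correlation is continuous, so dividing by `h` and
letting `h → 0+` gives the claim. -/

noncomputable section

namespace Parabolic

/-! ### The abstract energy inequality -/

section Energy

variable {V H : Type*} [NormedAddCommGroup V] [InnerProductSpace ℝ V]
  [NormedAddCommGroup H] [InnerProductSpace ℝ H]

/-- The correlation `r ↦ ∫ (G(s - r), U(s)) ds` of two square integrable functions is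
continuous. -/
theorem continuous_correlation {G U : ℝ → V} (hG : MemLp G 2 volume) (hU : MemLp U 2 volume) :
    Continuous fun r : ℝ => ∫ s, inner ℝ (G (s - r)) (U s) := by
  let τ : C(ℝ, C(ℝ, ℝ)) :=
    (ContinuousMap.mk (fun a : ℝ × ℝ => a.2 - a.1) (by fun_prop)).curry
  have hτ : ∀ r : ℝ, MeasurePreserving (τ r) volume volume :=
    fun r => measurePreserving_sub_right volume r
  -- Translation acts continuously on `L²(ℝ)`; this is the source of continuity in the lag `r`.
  have hc : Continuous fun r : ℝ => Lp.compMeasurePreserving (τ r) (hτ r) (hG.toLp G) :=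
    Continuous.compMeasurePreservingLp continuous_const τ.continuous hτ (by simp)
  have hi : Continuous fun r : ℝ =>
      inner ℝ (Lp.compMeasurePreserving (τ r) (hτ r) (hG.toLp G)) (hU.toLp U) :=
    hc.inner continuous_const
  refine hi.congr fun r => ?_
  rw [L2.inner_def]
  refine integral_congr_ae ?_
  have h1 := Lp.coeFn_compMeasurePreserving (hG.toLp G) (hτ r)
  have h2 := (hτ r).quasiMeasurePreserving.ae_eq_comp hG.coeFn_toLp
  filter_upwards [h1, h2, hU.coeFn_toLp] with s h1 h2 h3
  rw [h1, h3, h2]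
  rfl

/-- Integrability for the Fubini theorem for the correlation. -/
theorem integrable_correlation {G U : ℝ → V} (hG : MemLp G 2 volume) (hU : MemLp U 2 volume)
    (h : ℝ) :
    Integrable (fun p : ℝ × ℝ => inner ℝ (G (p.1 - p.2)) (U p.1))
      (volume.prod (volume.restrict (Set.Ioc 0 h))) := by
  have hG2 : Integrable (fun s => ‖G s‖ ^ 2) volume := hG.integrable_norm_pow (by simp)
  have hU2 : Integrable (fun s => ‖U s‖ ^ 2) volume := hU.integrable_norm_pow (by simp)
  have hqmp : Measure.QuasiMeasurePreserving (fun p : ℝ × ℝ => p.1 - p.2)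
      (volume.prod (volume.restrict (Set.Ioc 0 h))) volume :=
    (quasiMeasurePreserving_sub volume volume).mono_left
      (Measure.AbsolutelyContinuous.prod .rfl Measure.restrict_le_self.absolutelyContinuous)
  have hmeas : AEStronglyMeasurable (fun p : ℝ × ℝ => inner ℝ (G (p.1 - p.2)) (U p.1))
      (volume.prod (volume.restrict (Set.Ioc 0 h))) :=
    (hG.1.comp_quasiMeasurePreserving hqmp).inner hU.1.comp_fst
  have hI1 : Integrable (fun p : ℝ × ℝ => ‖G (p.1 - p.2)‖ ^ 2)
      (volume.prod (volume.restrict (Set.Ioc 0 h))) := by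
    have hone : Integrable (fun _ : ℝ => (1 : ℝ)) (volume.restrict (Set.Ioc 0 h)) :=
      integrable_const _
    have := hone.convolution_integrand (ContinuousLinearMap.mul ℝ ℝ) hG2
    simpa using this
  -- Here the finite length of `(0,h]` is essential, since the integrand does not depend on the lag.
  have hI2 : Integrable (fun p : ℝ × ℝ => ‖U p.1‖ ^ 2)
      (volume.prod (volume.restrict (Set.Ioc 0 h))) := hU2.comp_fst _
  refine (hI1.add hI2).mono' hmeas (Eventually.of_forall fun p => ?_)
  have := norm_inner_le_norm (𝕜 := ℝ) (G (p.1 - p.2)) (U p.1)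
  simp only [Pi.add_apply]
  nlinarith [sq_nonneg (‖G (p.1 - p.2)‖ - ‖U p.1‖), sq_nonneg (‖G (p.1 - p.2)‖),
    sq_nonneg ‖U p.1‖]

/-- The energy inequality for `du/dt = g` with `u ∈ L²(0,T; V)`, `g ∈ L²(0,T; V)` (where `V` is
identified with its dual), with respect to `J : V → H`. -/
theorem energy_inequality [CompleteSpace V] (J : V →L[ℝ] H) {T : ℝ} {u g : ℝ → V} {u0 : ℝ → H}
    (hu : MemLp u 2 (volume.restrict (Set.Icc 0 T)))
    (hg : MemLp g 2 (volume.restrict (Set.Icc 0 T)))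
    (hcont : Continuous u0) (hzero : ∀ s ≤ 0, u0 s = 0)
    (hagree : ∀ᵐ s ∂(volume.restrict (Set.Icc 0 T)), J (u s) = u0 s)
    (heq : ∀ s ∈ Set.Icc 0 T, ∀ w : V, inner ℝ (u0 s) (J w) = ∫ r in (0 : ℝ)..s, inner ℝ (g r) w)
    {t : ℝ} (ht0 : 0 < t) (htT : t ≤ T) :
    ‖u0 t‖ ^ 2 ≤ 2 * ∫ s in (0 : ℝ)..t, inner ℝ (g s) (u s) := by
  -- Extending `g` by zero keeps the integrated equation valid for negative times, so `s - h` needs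
  -- no separate treatment. Cutting `u` off at `t` turns integrals over `ℝ` into integrals over
  -- `[0,t]`.
  set G : ℝ → V := (Set.Icc 0 T).indicator g with hGdef
  set U : ℝ → V := (Set.Icc 0 t).indicator u with hUdef
  have hG : MemLp G 2 volume := (memLp_indicator_iff_restrict measurableSet_Icc).2 hg
  have hsub : Set.Icc 0 t ⊆ Set.Icc 0 T := Set.Icc_subset_Icc_right htT
  have hU : MemLp U 2 volume :=
    (memLp_indicator_iff_restrict measurableSet_Icc).2
      (hu.mono_measure (Measure.restrict_mono_set _ hsub))
  set Φ : ℝ → ℝ := fun r => ∫ s, inner ℝ (G (s - r)) (U s) with hΦ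
  have hΦc : Continuous Φ := continuous_correlation hG hU
  have hGint : ∀ a b : ℝ, ∀ w : V, IntervalIntegrable (fun r => inner ℝ (G r) w) volume a b := by
    intro a b w
    have : IsFiniteMeasure (volume.restrict (Set.uIoc a b)) := by
      unfold Set.uIoc; infer_instance
    have h1 : IntegrableOn G (Set.uIoc a b) volume :=
      ((hG.restrict (Set.uIoc a b)).integrable (by norm_num))
    exact intervalIntegrable_iff.2 (h1.inner_const w)
  have heq' : ∀ s ≤ T, ∀ w : V, inner ℝ (u0 s) (J w) = ∫ r in (0 : ℝ)..s, inner ℝ (G r) w := by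
    intro s hs w
    rcases le_or_gt 0 s with h0 | h0
    · rw [heq s ⟨h0, hs⟩ w]
      refine intervalIntegral.integral_congr fun r hr => ?_
      rw [Set.uIcc_of_le h0] at hr
      simp only [hGdef]
      rw [Set.indicator_of_mem (show r ∈ Set.Icc 0 T from ⟨hr.1, hr.2.trans hs⟩)]
    · rw [hzero s h0.le, inner_zero_left, intervalIntegral.integral_symm]
      symm
      rw [neg_eq_zero]
      refine intervalIntegral.integral_zero_ae ?_
      -- The end point `r = 0` of `(s,0]` does lie in `[0,T]`, so it is discarded as a null set.
      have : ∀ᵐ r : ℝ, r ≠ 0 := by simp [ae_iff]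
      filter_upwards [this] with r hr0 hr
      rw [Set.uIoc_of_le h0.le] at hr
      have : r ∉ Set.Icc 0 T := fun h => hr0 (le_antisymm hr.2 h.1)
      simp [hGdef, Set.indicator_of_notMem this]
  have hincr : ∀ h ∈ Set.Ioo 0 t, ∫ s in (t - h)..t, ‖u0 s‖ ^ 2 ≤ 2 * ∫ r in (0 : ℝ)..h, Φ r := by
    intro h hh
    have hψ : Continuous fun s => ‖u0 s‖ ^ 2 := by fun_prop
    have hψ' : Continuous fun s => ‖u0 (s - h)‖ ^ 2 := by fun_prop
    have hI := integrable_correlation hG hU h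
    have hswap : ∫ r in (0 : ℝ)..h, Φ r =
        ∫ s, ∫ r in (0 : ℝ)..h, inner ℝ (G (s - r)) (U s) := by
      simp only [hΦ, intervalIntegral.integral_of_le hh.1.le]
      exact (integral_integral_swap hI).symm
    have hset : ∫ s, ∫ r in (0 : ℝ)..h, inner ℝ (G (s - r)) (U s) =
        ∫ s in Set.Icc 0 t, ∫ r in (0 : ℝ)..h, inner ℝ (G (s - r)) (U s) := by
      refine (setIntegral_eq_integral_of_forall_compl_eq_zero fun s hs => ?_).symm
      simp [hUdef, Set.indicator_of_notMem hs]
    have hint : IntegrableOn (fun s => ∫ r in (0 : ℝ)..h, inner ℝ (G (s - r)) (U s))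
        (Set.Icc 0 t) := by
      simp only [intervalIntegral.integral_of_le hh.1.le]
      exact hI.integral_prod_left.integrableOn
    have hmono : ∫ s in Set.Icc 0 t, (‖u0 s‖ ^ 2 - ‖u0 (s - h)‖ ^ 2) ≤
        ∫ s in Set.Icc 0 t, 2 * ∫ r in (0 : ℝ)..h, inner ℝ (G (s - r)) (U s) := by
      refine integral_mono_ae ((hψ.sub hψ').integrableOn_Icc) (hint.const_mul 2) ?_
      have hag : ∀ᵐ s ∂(volume.restrict (Set.Icc 0 t)), J (u s) = u0 s :=
        ae_restrict_of_ae_restrict_of_subset hsub hagree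
      filter_upwards [hag, ae_restrict_mem measurableSet_Icc] with s hs hmem
      have hUs : U s = u s := Set.indicator_of_mem hmem u
      -- The equations at the times `s` and `s - h` are subtracted and tested with the fixed vector
      -- `w = u s`.
      have hdiff : inner ℝ (u0 s - u0 (s - h)) (u0 s) =
          ∫ r in (0 : ℝ)..h, inner ℝ (G (s - r)) (U s) := by
        rw [hUs, intervalIntegral.integral_comp_sub_left (fun r => inner ℝ (G r) (u s)) s,
          sub_zero, ← intervalIntegral.integral_interval_sub_left (hGint 0 s _) (hGint 0 (s - h) _),
          ← heq' s (hmem.2.trans htT), ← heq' (s - h) (by linarith [hmem.2, hh.1]),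
          ← inner_sub_left, hs]
      rw [← hdiff, inner_sub_left, real_inner_self_eq_norm_sq]
      -- With `a = u0 s` and `c = u0 (s - h)`: `‖a‖² - ‖c‖² = 2(a - c, a) - ‖a - c‖²`, and the last
      -- square is dropped.
      have := norm_sub_sq_real (u0 (s - h)) (u0 s)
      nlinarith [sq_nonneg ‖u0 (s - h) - u0 s‖]
    rw [integral_const_mul, ← hset, ← hswap] at hmono
    refine le_trans (le_of_eq ?_) hmono
    rw [integral_Icc_eq_integral_Ioc, ← intervalIntegral.integral_of_le ht0.le,
      intervalIntegral.integral_sub (hψ.intervalIntegrable _ _) (hψ'.intervalIntegrable _ _),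
      intervalIntegral.integral_comp_sub_right (fun s => ‖u0 s‖ ^ 2) h]
    -- The shifted integral runs over `[-h, t-h]`; as `u0` vanishes on `[-h,0]`, only the piece over
    -- `[t-h,t]` survives in the difference.
    have hz : ∫ s in (0 - h)..0, ‖u0 s‖ ^ 2 = 0 := by
      rw [intervalIntegral.integral_congr (g := fun _ => (0 : ℝ)) fun s hs => ?_]
      · simp
      · rw [Set.uIcc_of_le (by linarith [hh.1])] at hs
        simp [hzero s hs.2]
    have h1 := intervalIntegral.integral_add_adjacent_intervals
      (hψ.intervalIntegrable (μ := volume) (0 - h) 0) (hψ.intervalIntegrable 0 (t - h))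
    have h2 := intervalIntegral.integral_add_adjacent_intervals
      (hψ.intervalIntegrable (μ := volume) 0 (t - h)) (hψ.intervalIntegrable (t - h) t)
    linarith
  -- Both sides of `hincr` vanish at `h = 0`, so the inequality passes to their right slopes there.
  have hA : HasDerivAt (fun h => ∫ s in (t - h)..t, ‖u0 s‖ ^ 2) (‖u0 t‖ ^ 2) 0 := by
    have hψ : Continuous fun s => ‖u0 s‖ ^ 2 := by fun_prop
    have h1 : HasDerivAt (fun a => ∫ s in a..t, ‖u0 s‖ ^ 2) (-‖u0 t‖ ^ 2) (t - 0) := by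
      rw [sub_zero]
      exact intervalIntegral.integral_hasDerivAt_left (hψ.intervalIntegrable _ _)
        (hψ.stronglyMeasurableAtFilter _ _) hψ.continuousAt
    have h2 : HasDerivAt (fun h : ℝ => t - h) (-1) 0 := by
      simpa using (hasDerivAt_id (0 : ℝ)).const_sub t
    have := h1.comp (0 : ℝ) h2
    simpa [Function.comp_def] using this
  have hB : HasDerivAt (fun h => 2 * ∫ r in (0 : ℝ)..h, Φ r) (2 * Φ 0) 0 :=
    (hΦc.integral_hasStrictDerivAt 0 0).hasDerivAt.const_mul 2
  have hfin : Φ 0 = ∫ s in (0 : ℝ)..t, inner ℝ (g s) (u s) := by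
    rw [intervalIntegral.integral_of_le ht0.le, ← integral_Icc_eq_integral_Ioc,
      ← integral_indicator measurableSet_Icc]
    refine integral_congr_ae (Eventually.of_forall fun s => ?_)
    by_cases hs : s ∈ Set.Icc 0 t
    · simp [hGdef, hUdef, Set.indicator_of_mem hs, Set.indicator_of_mem (hsub hs)]
    · simp [hUdef, Set.indicator_of_notMem hs]
  rw [← hfin]
  refine le_of_tendsto_of_tendsto hA.tendsto_slope_zero_right hB.tendsto_slope_zero_right ?_
  filter_upwards [Ioo_mem_nhdsGT ht0] with h hh
  simpa using mul_le_mul_of_nonneg_left (hincr h hh) (inv_nonneg.2 hh.1.le)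

end Energy

/-! ### Matrix inequalities and measurability -/

section Matrices

variable {n : ℕ}

theorem inner_mulV (A : Matrix (Fin n) (Fin n) ℝ) (v w : Rn n) :
    inner ℝ v (mulV A w) = v.ofLp ⬝ᵥ A.mulVec w.ofLp := by
  rw [EuclideanSpace.inner_eq_star_dotProduct, dotProduct_comm]
  simp [mulV]

theorem mulV_add (A : Matrix (Fin n) (Fin n) ℝ) (v w : Rn n) :
    mulV A (v + w) = mulV A v + mulV A w := by
  simp [mulV, Matrix.mulVec_add]

theorem mulV_smul (A : Matrix (Fin n) (Fin n) ℝ) (c : ℝ) (v : Rn n) :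
    mulV A (c • v) = c • mulV A v := by
  simp [mulV, Matrix.mulVec_smul]

theorem inner_mulV_comm {A : Matrix (Fin n) (Fin n) ℝ} (hA : A.IsSymm) (v w : Rn n) :
    inner ℝ v (mulV A w) = inner ℝ w (mulV A v) := by
  rw [inner_mulV, inner_mulV, Matrix.dotProduct_mulVec, dotProduct_comm, ← Matrix.mulVec_transpose,
    hA.eq]

theorem mulV_mulV_inv {A : Matrix (Fin n) (Fin n) ℝ} (hA : IsUnit A.det) (v : Rn n) :
    mulV A (mulV A⁻¹ v) = v := by
  simp [mulV, Matrix.mulVec_mulVec, Matrix.mul_nonsing_inv A hA]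

theorem isUnit_det_of_coercive {A : Matrix (Fin n) (Fin n) ℝ} {δ : ℝ} (hδ : 0 < δ)
    (hA : ∀ ξ : Rn n, δ * ‖ξ‖ ^ 2 ≤ inner ℝ ξ (mulV A ξ)) : IsUnit A.det := by
  rw [isUnit_iff_ne_zero]
  intro h
  obtain ⟨v, hv, hAv⟩ := Matrix.exists_mulVec_eq_zero_iff.2 h
  have h1 := hA (WithLp.toLp 2 v)
  rw [inner_mulV] at h1
  simp only [hAv, dotProduct_zero] at h1
  have h2 : 0 < ‖WithLp.toLp 2 v‖ := norm_pos_iff.2 (by simpa using hv)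
  have : 0 < δ * ‖WithLp.toLp 2 v‖ ^ 2 := by positivity
  linarith

/-- Young's inequality for the scalar product weighted by a symmetric positive definite matrix. -/
theorem neg_inner_le_of_coercive {A : Matrix (Fin n) (Fin n) ℝ} {δ : ℝ} (hδ : 0 < δ)
    (hs : A.IsSymm) (hA : ∀ ξ : Rn n, δ * ‖ξ‖ ^ 2 ≤ inner ℝ ξ (mulV A ξ)) {θ : ℝ} (hθ : 0 < θ)
    (w p : Rn n) :
    -inner ℝ w p ≤ θ * inner ℝ p (mulV A p) + 1 / (4 * θ) * inner ℝ w (mulV A⁻¹ w) := by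
  have hu := isUnit_det_of_coercive hδ hA
  set q := mulV A⁻¹ w with hq
  have hAq : mulV A q = w := mulV_mulV_inv hu w
  -- Completing the square: `θ` times this form is the difference of the two sides of the claim,
  -- because `A q = w`.
  have h0 : 0 ≤ inner ℝ (p + (1 / (2 * θ)) • q) (mulV A (p + (1 / (2 * θ)) • q)) :=
    le_trans (by positivity) (hA _)
  rw [mulV_add, mulV_smul, hAq, inner_add_left, inner_add_right, inner_add_right,
    inner_smul_left, inner_smul_right, inner_smul_left, inner_smul_right,
    inner_mulV_comm hs q p, hAq, real_inner_comm w p, real_inner_comm w q] at h0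
  simp only [RCLike.conj_to_real] at h0
  have h1 := mul_nonneg hθ.le h0
  have e : θ * (inner ℝ p (mulV A p) + 1 / (2 * θ) * inner ℝ w p
      + (1 / (2 * θ) * inner ℝ w p + 1 / (2 * θ) * (1 / (2 * θ) * inner ℝ w q))) =
      θ * inner ℝ p (mulV A p) + inner ℝ w p + 1 / (4 * θ) * inner ℝ w q := by
    field_simp; ring
  linarith

/-- Cauchy–Schwarz applied to each row. -/
theorem norm_mulV_le (A : Matrix (Fin n) (Fin n) ℝ) (v : Rn n) :
    ‖mulV A v‖ ≤ frobenius A * ‖v‖ := by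
  refine le_of_sq_le_sq ?_ (mul_nonneg (Real.sqrt_nonneg _) (norm_nonneg _))
  have h0 : 0 ≤ ∑ i, ∑ j, A i j ^ 2 :=
    Finset.sum_nonneg fun i _ => Finset.sum_nonneg fun j _ => sq_nonneg _
  rw [mul_pow, frobenius, Real.sq_sqrt h0, EuclideanSpace.real_norm_sq_eq,
    EuclideanSpace.real_norm_sq_eq, Finset.sum_mul]
  refine Finset.sum_le_sum fun i _ => ?_
  exact Finset.sum_mul_sq_le_sq_mul_sq Finset.univ (A i) v.ofLp

theorem aemeasurable_mulV {α : Type*} [MeasurableSpace α] {μ : Measure α}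
    {A : α → Matrix (Fin n) (Fin n) ℝ} {v : α → Rn n}
    (hA : ∀ i j, AEMeasurable (fun a => A a i j) μ) (hv : AEMeasurable v μ) :
    AEMeasurable (fun a => mulV (A a) (v a)) μ := by
  refine (WithLp.measurable_toLp 2 (Fin n → ℝ)).comp_aemeasurable ?_
  refine aemeasurable_pi_lambda _ fun i => ?_
  simp only [Matrix.mulVec, dotProduct]
  refine Finset.aemeasurable_fun_sum _ fun j _ => (hA i j).mul ?_
  exact ((measurable_pi_apply j).comp (WithLp.measurable_ofLp 2 (Fin n → ℝ))).comp_aemeasurable hv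

/-- Determinant and adjugate are polynomial in the entries, and `A⁻¹ = (det A)⁻¹ • adj A` holds also
for singular `A`, where both sides are `0` by convention. -/
theorem aemeasurable_matrix_inv {α : Type*} [MeasurableSpace α] {μ : Measure α}
    {A : α → Matrix (Fin n) (Fin n) ℝ} (hA : ∀ i j, AEMeasurable (fun a => A a i j) μ)
    (i j : Fin n) : AEMeasurable (fun a => (A a)⁻¹ i j) μ := by
  let E : (Fin n → Fin n → ℝ) → ℝ := fun m => (Matrix.of m).det⁻¹ * (Matrix.of m).adjugate i j
  have hof : Continuous fun m : Fin n → Fin n → ℝ => Matrix.of m := continuous_id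
  have h1 : Measurable fun m : Fin n → Fin n → ℝ => (Matrix.of m).det :=
    hof.matrix_det.measurable
  have h2 : Measurable fun m : Fin n → Fin n → ℝ => (Matrix.of m).adjugate i j :=
    (hof.matrix_adjugate.matrix_elem i j).measurable
  have hE : Measurable E := h1.inv.mul h2
  have := hE.comp_aemeasurable (aemeasurable_pi_lambda (fun a i j => A a i j)
    fun i => aemeasurable_pi_lambda _ fun j => hA i j)
  refine this.congr (Eventually.of_forall fun a => ?_)
  simp only [Function.comp_apply, E, Matrix.inv_def, Ring.inverse_eq_inv', Matrix.smul_apply,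
    smul_eq_mul]
  rfl

end Matrices

theorem integrable_inner_of_memLp {α E : Type*} [MeasurableSpace α] {μ : Measure α}
    [NormedAddCommGroup E] [InnerProductSpace ℝ E] {f g : α → E} (hf : MemLp f 2 μ)
    (hg : MemLp g 2 μ) : Integrable (fun a => inner ℝ (f a) (g a)) μ := by
  refine (L2.integrable_inner (𝕜 := ℝ) (hf.toLp f) (hg.toLp g)).congr ?_
  filter_upwards [hf.coeFn_toLp, hg.coeFn_toLp] with a h1 h2
  rw [h1, h2]

theorem frobenius_nonneg {n : ℕ} (A : Matrix (Fin n) (Fin n) ℝ) : 0 ≤ frobenius A :=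
  Real.sqrt_nonneg _

/-- The pointwise estimate behind the energy estimate. -/
theorem pointwise_energy_estimate {n : ℕ} {A : Matrix (Fin n) (Fin n) ℝ} {δ C ε : ℝ} (hδ : 0 < δ)
    (hε : 0 < ε) (hε1 : ε < 1) (hs : A.IsSymm)
    (hA : ∀ ξ : Rn n, δ * ‖ξ‖ ^ 2 ≤ inner ℝ ξ (mulV A ξ)) {f : Rn n} {l : ℝ} (hf : ‖f‖ ≤ C)
    (hl : |l| ≤ C) (p w : Rn n) (v w0 : ℝ) :
    2 * (-inner ℝ (mulV A p) p + (inner ℝ f p + l * v) * v - inner ℝ w p + w0 * v) ≤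
      1 / (2 * (1 - ε)) * inner ℝ w (mulV A⁻¹ w) + ε * w0 ^ 2 +
        (C ^ 2 / (2 * ε * δ) + 2 * C + 1 / ε) * v ^ 2 := by
  -- Young's inequality is used with `θ = 1 - ε`, leaving the fraction `ε` of the dissipation for
  -- the drift term.
  have hθ : 0 < 1 - ε := by linarith
  have h1 := neg_inner_le_of_coercive hδ hs hA hθ w p
  have h2 := hA p
  rw [real_inner_comm p (mulV A p)]
  have e1 : 2 * (1 / (4 * (1 - ε)) * inner ℝ w (mulV A⁻¹ w)) =
      1 / (2 * (1 - ε)) * inner ℝ w (mulV A⁻¹ w) := by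
    field_simp; ring
  have h3 : inner ℝ f p * v ≤ C * ‖p‖ * |v| := by
    refine (le_abs_self _).trans ?_
    rw [abs_mul]
    gcongr
    exact (abs_real_inner_le_norm f p).trans (by gcongr)
  -- The weight `2εδ` is exactly what the reserved dissipation `2ε (p, Ap)` controls by coercivity.
  have h4 : 2 * (C * ‖p‖ * |v|) ≤ 2 * ε * δ * ‖p‖ ^ 2 + C ^ 2 / (2 * ε * δ) * v ^ 2 := by
    have h := sq_nonneg (2 * ε * δ * ‖p‖ - C * |v|)
    have hpos : 0 < 2 * ε * δ := by positivity
    have : 2 * ε * δ * ‖p‖ ^ 2 + C ^ 2 / (2 * ε * δ) * v ^ 2 - 2 * (C * ‖p‖ * |v|) =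
        (2 * ε * δ * ‖p‖ - C * |v|) ^ 2 / (2 * ε * δ) := by
      rw [← sq_abs v]; field_simp; ring
    have := div_nonneg h hpos.le
    linarith
  have h5 : l * v * v ≤ C * v ^ 2 := by
    have : l ≤ C := (le_abs_self l).trans hl
    nlinarith [sq_nonneg v]
  have h6 : 2 * (w0 * v) ≤ ε * w0 ^ 2 + 1 / ε * v ^ 2 := by
    have : ε * w0 ^ 2 + 1 / ε * v ^ 2 - 2 * (w0 * v) = (ε * w0 - v) ^ 2 / ε := by
      field_simp; ring
    have := div_nonneg (sq_nonneg (ε * w0 - v)) hε.le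
    linarith
  have h7 : ε * (δ * ‖p‖ ^ 2) ≤ ε * inner ℝ p (mulV A p) := by gcongr
  nlinarith

/-! ### The energy estimate at a fixed time -/

section Slice

variable {n : ℕ} {D : Set (Rn n)}

theorem toL2_ae {V : Type} [NormedAddCommGroup V] {g : Rn n → V}
    (hg : MemLp g 2 (spaceMeasure D)) : toL2 D g =ᵐ[spaceMeasure D] g := by
  rw [toL2, dif_pos hg]
  exact hg.coeFn_toLp

theorem divergence_toL2_apply {G : Rn n → Rn n} (hG : MemLp G 2 (spaceMeasure D)) (z : H1 D) :
    divergence (toL2 D G) z = -∫ x in D, inner ℝ (G x) (H1.grad D z x) := by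
  simp only [divergence, neg_apply, ContinuousLinearMap.comp_apply,
    innerSL_apply_apply, L2.inner_def]
  congr 1
  refine integral_congr_ae ?_
  filter_upwards [toL2_ae hG] with x hx
  rw [hx]

theorem toHneg1_toL2_apply {g : Rn n → ℝ} (hg : MemLp g 2 (spaceMeasure D)) (z : H1 D) :
    H0.toHneg1 (toL2 D g) z = ∫ x in D, g x * H1.toH0 D z x := by
  simp only [H0.toHneg1, ContinuousLinearMap.comp_apply, innerSL_apply_apply, L2.inner_def]
  refine integral_congr_ae ?_
  filter_upwards [toL2_ae hg] with x hx
  rw [hx]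
  simp [mul_comm]

theorem norm_toH0_sq (z : H1 D) : ‖H1.toH0 D z‖ ^ 2 = ∫ x in D, H1.toH0 D z x ^ 2 := by
  rw [← real_inner_self_eq_norm_sq, L2.inner_def]
  refine integral_congr_ae (Eventually.of_forall fun x => ?_)
  simp [sq]

/-- The energy estimate at a fixed time. -/
theorem slice_energy_estimate (hD : MeasurableSet D) {b : Rn n → Matrix (Fin n) (Fin n) ℝ}
    {f : Rn n → Rn n} {lam : Rn n → ℝ} {F : Rn n → Rn n} {F0 : Rn n → ℝ} {δ C ε : ℝ} (hδ : 0 < δ)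
    (hε : 0 < ε) (hε1 : ε < 1)
    (hbm : ∀ i j, AEMeasurable (fun x => b x i j) (spaceMeasure D))
    (hfm : AEMeasurable f (spaceMeasure D)) (hlm : AEMeasurable lam (spaceMeasure D))
    (hs : ∀ x ∈ D, (b x).IsSymm)
    (hc : ∀ x ∈ D, ∀ ξ : Rn n, δ * ‖ξ‖ ^ 2 ≤ inner ℝ ξ (mulV (b x) ξ))
    (hbd : ∀ᵐ x ∂(spaceMeasure D),
      frobenius (b x) + frobenius ((b x)⁻¹) + ‖f x‖ + |lam x| ≤ C)
    (hF : MemLp F 2 (spaceMeasure D)) (hF0 : MemLp F0 2 (spaceMeasure D)) (z : H1 D) :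
    2 * ((divergence (toL2 D fun x => mulV (b x) (H1.grad D z x)) +
        H0.toHneg1 (toL2 D fun x =>
          inner ℝ (f x) (H1.grad D z x) + lam x * H1.toH0 D z x) +
        (divergence (toL2 D F) + H0.toHneg1 (toL2 D F0))) z) ≤
      1 / (2 * (1 - ε)) * (∫ x in D, inner ℝ (F x) (mulV ((b x)⁻¹) (F x))) +
        ε * (∫ x in D, F0 x ^ 2) +
        (C ^ 2 / (2 * ε * δ) + 2 * C + 1 / ε) * ‖H1.toH0 D z‖ ^ 2 := by
  have hp : MemLp (H1.grad D z) 2 (spaceMeasure D) := Lp.memLp _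
  have hv : MemLp (H1.toH0 D z) 2 (spaceMeasure D) := Lp.memLp _
  have hbd' : ∀ᵐ x ∂(spaceMeasure D), frobenius (b x) ≤ C ∧ frobenius ((b x)⁻¹) ≤ C ∧
      ‖f x‖ ≤ C ∧ |lam x| ≤ C := by
    filter_upwards [hbd] with x hx
    have h1 := frobenius_nonneg (b x)
    have h2 := frobenius_nonneg ((b x)⁻¹)
    have h3 := norm_nonneg (f x)
    have h4 := abs_nonneg (lam x)
    refine ⟨?_, ?_, ?_, ?_⟩ <;> linarith
  -- Square integrability of each product ensures that `toL2` is the class of that product and not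
  -- its default value `0`.
  have hbp : MemLp (fun x => mulV (b x) (H1.grad D z x)) 2 (spaceMeasure D) := by
    refine hp.of_le_mul (c := C) (aemeasurable_mulV hbm hp.1.aemeasurable).aestronglyMeasurable ?_
    filter_upwards [hbd'] with x hx
    exact (norm_mulV_le _ _).trans (mul_le_mul_of_nonneg_right hx.1 (norm_nonneg _))
  have hbF : MemLp (fun x => mulV ((b x)⁻¹) (F x)) 2 (spaceMeasure D) := by
    refine hF.of_le_mul (c := C) (aemeasurable_mulV (aemeasurable_matrix_inv hbm)
      hF.1.aemeasurable).aestronglyMeasurable ?_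
    filter_upwards [hbd'] with x hx
    exact (norm_mulV_le _ _).trans (mul_le_mul_of_nonneg_right hx.2.1 (norm_nonneg _))
  have hfp : MemLp (fun x => inner ℝ (f x) (H1.grad D z x)) 2 (spaceMeasure D) := by
    refine hp.of_le_mul (c := C) (hfm.aestronglyMeasurable.inner hp.1) ?_
    filter_upwards [hbd'] with x hx
    exact (norm_inner_le_norm _ _).trans (mul_le_mul_of_nonneg_right hx.2.2.1 (norm_nonneg _))
  have hlv : MemLp (fun x => lam x * H1.toH0 D z x) 2 (spaceMeasure D) := by
    refine hv.of_le_mul (c := C) (hlm.aestronglyMeasurable.mul hv.1) ?_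
    filter_upwards [hbd'] with x hx
    rw [norm_mul]
    exact mul_le_mul_of_nonneg_right hx.2.2.2 (norm_nonneg _)
  have hlow : MemLp (fun x => inner ℝ (f x) (H1.grad D z x) + lam x * H1.toH0 D z x) 2
      (spaceMeasure D) := hfp.add hlv
  have i1 : Integrable (fun x => inner ℝ (mulV (b x) (H1.grad D z x)) (H1.grad D z x))
      (spaceMeasure D) := integrable_inner_of_memLp hbp hp
  have i2 : Integrable (fun x => (inner ℝ (f x) (H1.grad D z x) + lam x * H1.toH0 D z x) *
      H1.toH0 D z x) (spaceMeasure D) := hlow.integrable_mul hv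
  have i3 : Integrable (fun x => inner ℝ (F x) (H1.grad D z x)) (spaceMeasure D) :=
    integrable_inner_of_memLp hF hp
  have i4 : Integrable (fun x => F0 x * H1.toH0 D z x) (spaceMeasure D) := hF0.integrable_mul hv
  have i5 : Integrable (fun x => inner ℝ (F x) (mulV ((b x)⁻¹) (F x))) (spaceMeasure D) :=
    integrable_inner_of_memLp hF hbF
  have i6 : Integrable (fun x => F0 x ^ 2) (spaceMeasure D) := hF0.integrable_sq
  have i7 : Integrable (fun x => H1.toH0 D z x ^ 2) (spaceMeasure D) := hv.integrable_sq
  simp only [add_apply]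
  rw [divergence_toL2_apply hbp, divergence_toL2_apply hF, toHneg1_toL2_apply hlow,
    toHneg1_toL2_apply hF0, norm_toH0_sq]
  have hmono := integral_mono_ae
    ((((i1.neg.add i2).sub i3).add i4).const_mul 2)
    (((i5.const_mul (1 / (2 * (1 - ε)))).add (i6.const_mul ε)).add
      (i7.const_mul (C ^ 2 / (2 * ε * δ) + 2 * C + 1 / ε))) (by
    filter_upwards [hbd', ae_restrict_mem hD] with x hx hxD
    exact pointwise_energy_estimate hδ hε hε1 (hs x hxD) (hc x hxD) hx.2.2.1 hx.2.2.2 _ _ _ _)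
  rw [integral_const_mul, integral_add' ((i1.neg.add i2).sub i3) i4,
    integral_sub' (i1.neg.add i2) i3, integral_add' i1.neg i2, integral_neg',
    integral_add' ((i5.const_mul _).add (i6.const_mul _)) (i7.const_mul _),
    integral_add' (i5.const_mul _) (i6.const_mul _), integral_const_mul, integral_const_mul,
    integral_const_mul] at hmono
  refine le_trans (le_of_eq ?_) hmono
  ring

end Slice

/-! ### From the cylinder to almost every time -/

variable {n : ℕ} {D : Set (Rn n)} {T : ℝ}

theorem frobenius_inv_le {b : Rn n → ℝ → Matrix (Fin n) (Fin n) ℝ} {f : Rn n → ℝ → Rn n}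
    {lam : Rn n → ℝ → ℝ} {C : ℝ} {p : Rn n × ℝ}
    (hp : frobenius (b p.1 p.2) + frobenius ((b p.1 p.2)⁻¹) + ‖f p.1 p.2‖ + |lam p.1 p.2| ≤ C) :
    frobenius ((b p.1 p.2)⁻¹) ≤ C := by
  have h1 := frobenius_nonneg (b p.1 p.2)
  have h3 := norm_nonneg (f p.1 p.2)
  have h4 := abs_nonneg (lam p.1 p.2)
  linarith

/-- The essential bound on `b⁻¹` makes `b⁻¹F` square integrable along with `F`. By Fubini this makes
`weightedForm` integrable in time, as needed for splitting the time integral of the energy estimate.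
-/
theorem integrable_weighted_cyl {b : Rn n → ℝ → Matrix (Fin n) (Fin n) ℝ}
    {f : Rn n → ℝ → Rn n} {lam : Rn n → ℝ → ℝ} (hcond : StandingConditions D T b f lam)
    {F : Rn n → ℝ → Rn n}
    (hF : MemLp (fun p : Rn n × ℝ => F p.1 p.2) 2 (cylMeasure D T)) :
    Integrable (fun p : Rn n × ℝ => inner ℝ (F p.1 p.2) (mulV ((b p.1 p.2)⁻¹) (F p.1 p.2)))
      (cylMeasure D T) := by
  obtain ⟨C, hC⟩ := hcond.bounded
  refine integrable_inner_of_memLp hF (hF.of_le_mul (c := C) (aemeasurable_mulV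
    (aemeasurable_matrix_inv hcond.measurable_b) hF.1.aemeasurable).aestronglyMeasurable ?_)
  filter_upwards [hC] with p hp
  exact (norm_mulV_le _ _).trans
    (mul_le_mul_of_nonneg_right (frobenius_inv_le hp) (norm_nonneg _))

theorem integrableOn_weightedForm {b : Rn n → ℝ → Matrix (Fin n) (Fin n) ℝ}
    {f : Rn n → ℝ → Rn n} {lam : Rn n → ℝ → ℝ} (hcond : StandingConditions D T b f lam)
    {F : Rn n → ℝ → Rn n}
    (hF : MemLp (fun p : Rn n × ℝ => F p.1 p.2) 2 (cylMeasure D T)) :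
    IntegrableOn (weightedForm D b F) (Set.Icc 0 T) :=
  (integrable_weighted_cyl hcond hF).integral_prod_right

/-- Almost every time slice of an a.e. measurable function on the cylinder is a.e. measurable. -/
theorem ae_aemeasurable_slice {E : Type*} [NormedAddCommGroup E] [SecondCountableTopology E]
    [MeasurableSpace E] [BorelSpace E] {G : Rn n → ℝ → E}
    (hG : AEMeasurable (fun p : Rn n × ℝ => G p.1 p.2) (cylMeasure D T)) :
    ∀ᵐ s ∂(timeMeasure T), AEMeasurable (fun x => G x s) (spaceMeasure D) := by
  filter_upwards [hG.aestronglyMeasurable.prod_swap.prodMk_left] with s hs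
  exact hs.aemeasurable

/-- Almost every time slice of a square integrable function on the cylinder is square
integrable. -/
theorem ae_memLp_slice {E : Type*} [NormedAddCommGroup E] {G : Rn n → ℝ → E}
    (hG : MemLp (fun p : Rn n × ℝ => G p.1 p.2) 2 (cylMeasure D T)) :
    ∀ᵐ s ∂(timeMeasure T), MemLp (fun x => G x s) 2 (spaceMeasure D) := by
  filter_upwards [hG.1.prod_swap.prodMk_left,
    ((memLp_two_iff_integrable_sq_norm hG.1).1 hG).prod_left_ae] with s h1 h2
  exact (memLp_two_iff_integrable_sq_norm h1).2 h2

/-- The energy estimate at almost every time. -/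
theorem ae_energy_estimate (hD : MeasurableSet D) {b : Rn n → ℝ → Matrix (Fin n) (Fin n) ℝ}
    {f : Rn n → ℝ → Rn n} {lam : Rn n → ℝ → ℝ} (hcond : StandingConditions D T b f lam)
    {phi : Xneg1 D T} {F0 : Rn n → ℝ → ℝ} {F : Rn n → ℝ → Rn n} (hF : Represents phi F0 F)
    (u : Y1 D T) {ε : ℝ} (hε : 0 < ε) (hε1 : ε < 1) :
    ∃ K : ℝ, ∀ᵐ s ∂(timeMeasure T),
      2 * (linearPart b f lam u s + phi s) (u.toX1 s) ≤
        1 / (2 * (1 - ε)) * weightedForm D b F s + ε * (∫ x in D, F0 x s ^ 2) +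
          K * ‖H1.toH0 D (u.toX1 s)‖ ^ 2 := by
  obtain ⟨C, hC⟩ := hcond.bounded
  obtain ⟨δ, hδ, hc⟩ := hcond.coercive
  refine ⟨C ^ 2 / (2 * ε * δ) + 2 * C + 1 / ε, ?_⟩
  have hb : ∀ᵐ s ∂(timeMeasure T), ∀ i j, AEMeasurable (fun x => b x s i j) (spaceMeasure D) :=
    ae_all_iff.2 fun i => ae_all_iff.2 fun j =>
      ae_aemeasurable_slice (G := fun x s => b x s i j) (hcond.measurable_b i j)
  have hC' : ∀ᵐ s ∂(timeMeasure T), ∀ᵐ x ∂(spaceMeasure D),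
      frobenius (b x s) + frobenius ((b x s)⁻¹) + ‖f x s‖ + |lam x s| ≤ C :=
    Measure.ae_ae_of_ae_prod
      (Measure.measurePreserving_swap.quasiMeasurePreserving.ae hC)
  -- Symmetry and ellipticity are assumed only for times in the open interval; its end points are
  -- null.
  have hmem : ∀ᵐ s ∂(timeMeasure T), s ∈ Set.Ioo 0 T := by
    rw [timeMeasure, ← Measure.restrict_congr_set Ioo_ae_eq_Icc]
    exact ae_restrict_mem measurableSet_Ioo
  filter_upwards [hb, ae_aemeasurable_slice hcond.measurable_f,
    ae_aemeasurable_slice hcond.measurable_lam, hC', hmem, ae_memLp_slice hF.memLp_F,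
    ae_memLp_slice hF.memLp_F0, hF.eq] with s h1 h2 h3 h4 h5 h6 h7 h8
  rw [h8]
  exact slice_energy_estimate hD hδ hε hε1 h1 h2 h3 (fun x hx => hcond.symmetric x hx s h5)
    (fun x hx => hc x hx s h5) h4 h6 h7 (u.toX1 s)

/-! ### Energy and small-time asymptotics of solutions -/

/-- The Riesz representative of `N(u)` is square integrable in time. -/
theorem IsSolution.memLp_riesz {N : Y1 D T → ℝ → Hneg1 D} {u : Y1 D T} (hu : IsSolution N u) :
    MemLp (fun s => (InnerProductSpace.toDual ℝ (H1 D)).symm (N u s)) 2 (timeMeasure T) :=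
  MemLp.of_le (g := N u) hu.memLp
    ((InnerProductSpace.toDual ℝ (H1 D)).symm.continuous.comp_aestronglyMeasurable hu.memLp.1)
    (Eventually.of_forall fun s =>
      ((InnerProductSpace.toDual ℝ (H1 D)).symm.norm_map (N u s)).le)

theorem IsSolution.integrableOn_pairing {N : Y1 D T → ℝ → Hneg1 D} {u : Y1 D T}
    (hu : IsSolution N u) : IntegrableOn (fun s => N u s (u.toX1 s)) (Set.Icc 0 T) := by
  have h := integrable_inner_of_memLp hu.memLp_riesz (Lp.memLp u.toX1)
  simp only [InnerProductSpace.toDual_symm_apply] at h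
  exact h

/-- Evaluation at `w` is bounded and linear, hence commutes with the Bochner integral. It turns the
equation in `H⁻¹` into the scalar identities required by `energy_inequality`. -/
theorem strongDual_intervalIntegral_apply {V : Type*} [NormedAddCommGroup V] [NormedSpace ℝ V]
    {N : ℝ → StrongDual ℝ V} (hN : MemLp N 2 (timeMeasure T)) {s : ℝ} (hs : s ∈ Set.Icc 0 T)
    (w : V) : (∫ r in (0 : ℝ)..s, N r) w = ∫ r in (0 : ℝ)..s, N r w := by
  refine ContinuousLinearMap.intervalIntegral_apply ?_ w
  rw [intervalIntegrable_iff, Set.uIoc_of_le hs.1]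
  have h : IntegrableOn N (Set.Icc 0 T) := hN.integrable (by norm_num)
  exact h.mono_set (Set.Ioc_subset_Icc_self.trans (Set.Icc_subset_Icc_right hs.2))

/-- The energy inequality for solutions. -/
theorem IsSolution.energy {N : Y1 D T → ℝ → Hneg1 D} {u : Y1 D T} (hu : IsSolution N u)
    (hT : 0 < T) {t : ℝ} (ht0 : 0 < t) (htT : t ≤ T) :
    ‖u.val t‖ ^ 2 ≤ 2 * ∫ s in (0 : ℝ)..t, N u s (u.toX1 s) := by
  have hval : ∀ s ∈ Set.Icc 0 T, Set.IccExtend hT.le u.toC0 s = u.val s := fun s hs => by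
    rw [Set.IccExtend_of_mem hT.le _ hs, Y1.val, dif_pos hs]
  have h := energy_inequality (H1.toH0 D) (u := fun s => u.toX1 s) (Lp.memLp u.toX1)
    hu.memLp_riesz
    (u0 := Set.IccExtend hT.le u.toC0) (u.toC0.continuous.Icc_extend') ?_ ?_ ?_ ht0 htT
  · rw [hval t ⟨ht0.le, htT⟩] at h
    simp only [InnerProductSpace.toDual_symm_apply] at h
    exact h
  -- The constant extension to negative times has the value `u(0) = 0`.
  · intro s hs
    rw [Set.IccExtend_of_le_left _ _ hs, ← hu.initial, ← hval 0 ⟨le_rfl, hT.le⟩,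
      Set.IccExtend_left]
  · filter_upwards [u.agree, ae_restrict_mem measurableSet_Icc] with s hs hmem
    rw [Set.IccExtend_of_mem _ _ hmem, hs hmem]
  · intro s hs w
    have h1 := DFunLike.congr_fun (hu.equation s hs) w
    rw [strongDual_intervalIntegral_apply hu.memLp hs] at h1
    rw [hval s hs]
    simp only [InnerProductSpace.toDual_symm_apply]
    exact h1

/-- The bound for `limsup ‖u(·,t)‖² / t` that keeps a small contribution of `F₀`. -/
theorem IsSolution.limsup_le (hD : MeasurableSet D) (hT : 0 < T)
    {b : Rn n → ℝ → Matrix (Fin n) (Fin n) ℝ}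
    {f : Rn n → ℝ → Rn n} {lam : Rn n → ℝ → ℝ} (hcond : StandingConditions D T b f lam)
    {phi : Xneg1 D T} {F0 : Rn n → ℝ → ℝ} {F : Rn n → ℝ → Rn n} (hF : Represents phi F0 F)
    {N : Y1 D T → ℝ → Hneg1 D} {u : Y1 D T} (hu : IsSolution N u)
    (hN : ∀ s, N u s = linearPart b f lam u s + phi s)
    (hF0lim : LimitConditionF0 D F0) (hFlim : LimitConditionF D b F)
    {ε : ℝ} (hε : 0 < ε) (hε1 : ε < 1) :
    limsup (fun t : ℝ => (((1 / t) * ‖u.val t‖ ^ 2 : ℝ) : EReal)) (𝓝[>] 0) ≤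
      ((1 / (2 * (1 - ε)) * weightedForm D b F 0 + ε * ∫ x in D, F0 x 0 ^ 2 : ℝ) : EReal) := by
  obtain ⟨K, hK⟩ := ae_energy_estimate hD hcond hF u hε hε1
  set ψ : ℝ → ℝ := fun s => ‖Set.IccExtend hT.le u.toC0 s‖ ^ 2 with hψdef
  have hψ : Continuous ψ := (u.toC0.continuous.Icc_extend').norm.pow 2
  have hψ0 : ψ 0 = 0 := by
    have h0 : (0 : ℝ) ∈ Set.Icc 0 T := ⟨le_rfl, hT.le⟩
    have h1 := hu.initial
    rw [Y1.val, dif_pos h0] at h1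
    simp only [hψdef]
    rw [Set.IccExtend_of_mem hT.le _ h0, h1]
    simp
  -- The limit is the right derivative at `0` of the primitive of `ψ`, that is `ψ 0 = 0`. Hence the
  -- size of `K` is irrelevant for fixed `ε`.
  have hψlim : Tendsto (fun t : ℝ => (1 / t) * ∫ s in (0 : ℝ)..t, ψ s) (𝓝[>] 0) (𝓝 0) := by
    have := (hψ.integral_hasStrictDerivAt 0 0).hasDerivAt.tendsto_slope_zero_right
    simpa [hψ0] using this
  have hlim : Tendsto (fun t : ℝ =>
      1 / (2 * (1 - ε)) * ((1 / t) * ∫ s in (0 : ℝ)..t, weightedForm D b F s) +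
        ε * ((1 / t) * ∫ s in (0 : ℝ)..t, ∫ x in D, F0 x s ^ 2) +
        K * ((1 / t) * ∫ s in (0 : ℝ)..t, ψ s)) (𝓝[>] 0)
      (𝓝 (1 / (2 * (1 - ε)) * weightedForm D b F 0 + ε * ∫ x in D, F0 x 0 ^ 2)) := by
    simpa using ((hFlim.tendsto.const_mul (1 / (2 * (1 - ε)))).add
      (hF0lim.tendsto.const_mul ε)).add (hψlim.const_mul K)
  rw [← ((continuous_coe_real_ereal.tendsto _).comp hlim).limsup_eq]
  -- In `EReal` the comparison of upper limits requires no a priori bound on `‖u(t)‖² / t`.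
  refine limsup_le_limsup ?_
  filter_upwards [Ioc_mem_nhdsGT hT] with t ht
  simp only [Function.comp_apply, EReal.coe_le_coe_iff]
  have hsub : Set.Ioc 0 t ⊆ Set.Icc 0 T :=
    Set.Ioc_subset_Icc_self.trans (Set.Icc_subset_Icc_right ht.2)
  have hii : ∀ {k : ℝ → ℝ}, IntegrableOn k (Set.Icc 0 T) → IntervalIntegrable k volume 0 t :=
    fun hk => (intervalIntegrable_iff_integrableOn_Ioc_of_le ht.1.le).2 (hk.mono_set hsub)
  have j1 := hii (integrableOn_weightedForm hcond hF.memLp_F)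
  have j2 : IntervalIntegrable (fun s => ∫ x in D, F0 x s ^ 2) volume 0 t :=
    hii (hF.memLp_F0.integrable_sq.integral_prod_right)
  have j3 : IntervalIntegrable ψ volume 0 t := hψ.intervalIntegrable _ _
  have hle : ∫ s in (0 : ℝ)..t, 2 * N u s (u.toX1 s) ≤
      ∫ s in (0 : ℝ)..t, (1 / (2 * (1 - ε)) * weightedForm D b F s +
        ε * (∫ x in D, F0 x s ^ 2) + K * ψ s) := by
    refine intervalIntegral.integral_mono_ae_restrict ht.1.le
      ((hii hu.integrableOn_pairing).const_mul 2)
      (((j1.const_mul _).add (j2.const_mul _)).add (j3.const_mul _)) ?_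
    have hsub' : Set.Icc 0 t ⊆ Set.Icc 0 T := Set.Icc_subset_Icc_right ht.2
    filter_upwards [ae_restrict_of_ae_restrict_of_subset hsub' hK,
      ae_restrict_of_ae_restrict_of_subset hsub' u.agree,
      ae_restrict_mem measurableSet_Icc] with s h1 h2 h3
    rw [hN]
    simp only [hψdef]
    rwa [Set.IccExtend_of_mem hT.le _ (hsub' h3), ← h2 (hsub' h3)]
  rw [intervalIntegral.integral_add ((j1.const_mul _).add (j2.const_mul _)) (j3.const_mul _),
    intervalIntegral.integral_add (j1.const_mul _) (j2.const_mul _),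
    intervalIntegral.integral_const_mul, intervalIntegral.integral_const_mul,
    intervalIntegral.integral_const_mul, intervalIntegral.integral_const_mul] at hle
  have := mul_le_mul_of_nonneg_left ((hu.energy hT ht.1 ht.2).trans hle)
    (one_div_nonneg.2 ht.1.le)
  linarith

end Parabolic

end

/-! ### Elimination of the parameter -/

theorem corollary3 (n : ℕ) (D : Set (Parabolic.Rn n)) (hDopen : IsOpen D)
    (hD : D = Set.univ ∨ (Bornology.IsBounded D ∧ Parabolic.HasC2Boundary D))
    (T : ℝ) (hT : 0 < T)
    (bhat : Parabolic.Y1 D T → Parabolic.Rn n → ℝ → Matrix (Fin n) (Fin n) ℝ)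
    (fhat : Parabolic.Y1 D T → Parabolic.Rn n → ℝ → Parabolic.Rn n)
    (lamhat : Parabolic.Y1 D T → Parabolic.Rn n → ℝ → ℝ)
    (phihat : Parabolic.Y1 D T → Parabolic.Xneg1 D T)
    (u : Parabolic.Y1 D T)
    (hcond : Parabolic.StandingConditions D T (bhat u) (fhat u) (lamhat u))
    (hu : Parabolic.IsSolution (Parabolic.nonlinOp bhat fhat lamhat phihat) u)
    (F0 : Parabolic.Rn n → ℝ → ℝ) (F : Parabolic.Rn n → ℝ → Parabolic.Rn n)
    (hF : Parabolic.Represents (phihat u) F0 F)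
    (hF0lim : Parabolic.LimitConditionF0 D F0)
    (hFlim : Parabolic.LimitConditionF D (bhat u) F) :
    limsup (fun t : ℝ => (((1 / t) * ‖u.val t‖ ^ 2 : ℝ) : EReal)) (𝓝[>] 0) ≤
      ((1 / 2 * Parabolic.weightedForm D (bhat u) F 0 : ℝ) : EReal) := by
  -- The upper limit in `t` does not involve `ε`, so its bound may be sent to `ε → 0+`; this is
  -- where the contribution of `F₀` disappears.
  have hlim : Tendsto (fun ε : ℝ =>
      1 / (2 * (1 - ε)) * Parabolic.weightedForm D (bhat u) F 0 + ε * ∫ x in D, F0 x 0 ^ 2)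
      (𝓝[>] 0) (𝓝 (1 / 2 * Parabolic.weightedForm D (bhat u) F 0)) := by
    have hc : ContinuousAt (fun ε : ℝ =>
        1 / (2 * (1 - ε)) * Parabolic.weightedForm D (bhat u) F 0 + ε * ∫ x in D, F0 x 0 ^ 2) 0 := by
      refine ContinuousAt.add (ContinuousAt.mul (ContinuousAt.div ?_ ?_ ?_) ?_) ?_
      · fun_prop
      · fun_prop
      · norm_num
      · fun_prop
      · fun_prop
    simpa using hc.tendsto.mono_left (nhdsWithin_le_nhds (s := Set.Ioi 0))
  refine ge_of_tendsto ((continuous_coe_real_ereal.tendsto _).comp hlim) ?_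
  filter_upwards [Ioo_mem_nhdsGT (zero_lt_one' ℝ)] with ε hε
  exact hu.limsup_le hDopen.measurableSet hT hcond hF (fun _ => rfl) hF0lim hFlim hε.1 hε.2
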